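/- Let $G$ be a countably infinite discrete amenable group and let $(F_N)_{N\ge 1}$ be a right-Følner sequence in $G$, i.e. a sequence of nonempty finite subsets of $G$ with $|F_N\triangle F_Ng|/|F_N|\to 0$ for every $g\in G$. Let $\mathcal H$ be a complex Hilbert space and let $u:G\to\mathcal H$ be bounded. Suppose that $$\sum_{h\in G}\ \limsup_{N\to\infty}\left|\frac1{|F_N|}\sum_{g\in F_N}\langle u(gh),u(g)\rangle\right|^2<\infty .$$ Then $u$ is spectrally Lebesgue, in the following sense. For $h\in G$ put $(U_hu)(g)=u(gh)$. Let $N_1<N_2<\cdots$ be any sequence of indices such that $((U_hu)_{h\in G},(F_{N_q})_{q})$ is a permissible pair, i.e. the limit $$\langle x,y\rangle_{\mathscr H}=\lim_{q\to\infty}\frac1{|F_{N_q}|}\sum_{g\in F_{N_q}}\langle x(g),y(g)\rangle$$ exists for all $x,y\in\{U_hu: h\in G\}$. Let $\mathscr H'$ be the complex linear span of $\{U_hu:h\in G\}$, let $\mathscr H''$ be the space of all $E:G\to\mathcal H$ with $\limsup_q\frac1{|F_{N_q}|}\sum_{g\in F_{N_q}}\|E(g)\|^2<\infty$ such that for every $\varepsilon>0$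 there is $E_\varepsilon\in\mathscr H'$ with $\limsup_q\frac1{|F_{N_q}|}\sum_{g\in F_{N_q}}\|E(g)-E_\varepsilon(g)\|^2<\varepsilon$, and let $\mathscr H=\mathscr H''/S$ with the inner product $\langle\cdot,\cdot\rangle_{\mathscr H}$ (the limit above exists for all $x,y\in\mathscr H''$), where $S$ is the set of $x\in\mathscr H''$ with $\lim_q\frac1{|F_{N_q}|}\sum_{g\in F_{N_q}}\|x(g)\|^2=0$. Then there is exactly one unitary representation $U$ of $G$ on $\mathscr H$ such that, for all $g,h\in G$, $U_g$ maps the class of $U_hu$ to the class of $U_{gh}u$, and $U$ is unitarily equivalent to a subrepresentation of the left regular representation $(L_gf)(x)=f(g^{-1}x)$ of $G$ on $\ell^2(G)$, that is, to its restriction to some closed invariant subspace of $\ell^2(G)$. -/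

import Mathlib

open Filter Topology

set_option linter.unusedSectionVars false

namespace VdC

noncomputable section

/-- A right Følner sequence of (nonempty) finite subsets of `G`:
`|F_n ∆ F_n g| / |F_n| → 0` for every `g`. -/
def IsRightFolner {G : Type*} [Group G] (F : ℕ → Finset G) : Prop :=
  (∀ n, (F n).Nonempty) ∧
    ∀ g : G, Tendsto
      (fun n => ((symmDiff (F n : Set G) ((fun x => x * g) '' (F n : Set G))).ncard : ℝ) /
        ((F n).card : ℝ))
      atTop (𝓝 0)

/-- The average `(1/|A|) ∑_{g ∈ A} φ g`. -/
def avg {G E : Type*} [AddCommGroup E] [Module ℝ E] (A : Finset G) (φ : G → E) : E :=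
  (A.card : ℝ)⁻¹ • ∑ g ∈ A, φ g

section Averages

variable {G H : Type*} [NormedAddCommGroup H] [InnerProductSpace ℂ H]

theorem avg_sq_nonneg (A : Finset G) (x : G → H) : 0 ≤ avg A (fun g => ‖x g‖ ^ 2) :=
  smul_nonneg (by positivity) (Finset.sum_nonneg fun _ _ => by positivity)

theorem avg_sq_add_le (A : Finset G) (x y : G → H) :
    avg A (fun g => ‖(x + y) g‖ ^ 2) ≤
      2 * avg A (fun g => ‖x g‖ ^ 2) + 2 * avg A (fun g => ‖y g‖ ^ 2) := by
  have h : ∑ g ∈ A, ‖(x + y) g‖ ^ 2 ≤ 2 * ∑ g ∈ A, ‖x g‖ ^ 2 + 2 * ∑ g ∈ A, ‖y g‖ ^ 2 := by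
    rw [Finset.mul_sum, Finset.mul_sum, ← Finset.sum_add_distrib]
    refine Finset.sum_le_sum fun g _ => ?_
    have h1 : ‖(x + y) g‖ ≤ ‖x g‖ + ‖y g‖ := norm_add_le _ _
    nlinarith [norm_nonneg ((x + y) g), sq_nonneg (‖x g‖ - ‖y g‖)]
  have h2 := mul_le_mul_of_nonneg_left h (show (0 : ℝ) ≤ (A.card : ℝ)⁻¹ by positivity)
  simp only [avg, smul_eq_mul]
  linarith

theorem avg_sq_smul (A : Finset G) (c : ℂ) (x : G → H) :
    avg A (fun g => ‖(c • x) g‖ ^ 2) = ‖c‖ ^ 2 * avg A (fun g => ‖x g‖ ^ 2) := by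
  simp only [avg, Pi.smul_apply, norm_smul, mul_pow, ← Finset.mul_sum, smul_eq_mul]
  ring

theorem avg_inner_add_left (A : Finset G) (x y z : G → H) :
    avg A (fun g => inner ℂ ((x + y) g) (z g)) =
      avg A (fun g => inner ℂ (x g) (z g)) + avg A (fun g => inner ℂ (y g) (z g)) := by
  simp only [avg, Pi.add_apply, inner_add_left, Finset.sum_add_distrib, smul_add]

theorem avg_inner_smul_left (A : Finset G) (c : ℂ) (x y : G → H) :
    avg A (fun g => inner ℂ ((c • x) g) (y g)) =
      (starRingEnd ℂ) c * avg A (fun g => inner ℂ (x g) (y g)) := by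
  simp only [avg, Pi.smul_apply, inner_smul_left, ← Finset.mul_sum, mul_smul_comm]

theorem avg_inner_conj (A : Finset G) (x y : G → H) :
    (starRingEnd ℂ) (avg A (fun g => inner ℂ (y g) (x g))) =
      avg A (fun g => inner ℂ (x g) (y g)) := by
  simp [avg]

theorem avg_inner_self (A : Finset G) (x : G → H) :
    avg A (fun g => inner ℂ (x g) (x g)) = ((avg A (fun g => ‖x g‖ ^ 2) : ℝ) : ℂ) := by
  simp [avg, inner_self_eq_norm_sq_to_K]

theorem avg_inner_sq_le (A : Finset G) (x y : G → H) :
    ‖avg A (fun g => inner ℂ (x g) (y g))‖ ^ 2 ≤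
      avg A (fun g => ‖x g‖ ^ 2) * avg A (fun g => ‖y g‖ ^ 2) := by
  have h1 : ‖∑ g ∈ A, inner ℂ (x g) (y g)‖ ≤ ∑ g ∈ A, ‖x g‖ * ‖y g‖ :=
    (norm_sum_le _ _).trans (Finset.sum_le_sum fun g _ => norm_inner_le_norm _ _)
  have h2 : ‖∑ g ∈ A, inner ℂ (x g) (y g)‖ ^ 2 ≤
      (∑ g ∈ A, ‖x g‖ ^ 2) * ∑ g ∈ A, ‖y g‖ ^ 2 :=
    (pow_le_pow_left₀ (norm_nonneg _) h1 2).trans (Finset.sum_mul_sq_le_sq_mul_sq _ _ _)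
  have h3 := mul_le_mul_of_nonneg_left h2 (show (0 : ℝ) ≤ ((A.card : ℝ)⁻¹) ^ 2 by positivity)
  simp only [avg, smul_eq_mul, norm_smul, mul_pow, norm_inv, Real.norm_natCast]
  linarith

/-- `f ∈ SA(H, (F_n))`: `limsup_n (1/|F_n|) ∑_{g ∈ F_n} ‖f g‖² < ∞`. -/
def SquareAverageable (F : ℕ → Finset G) (f : G → H) : Prop :=
  IsBoundedUnder (· ≤ ·) atTop (fun n => avg (F n) (fun g => ‖f g‖ ^ 2))

theorem SquareAverageable.add {F : ℕ → Finset G} {x y : G → H}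
    (hx : SquareAverageable F x) (hy : SquareAverageable F y) : SquareAverageable F (x + y) := by
  obtain ⟨a, ha⟩ := hx
  obtain ⟨b, hb⟩ := hy
  rw [eventually_map] at ha hb
  refine ⟨2 * a + 2 * b, ?_⟩
  rw [eventually_map]
  filter_upwards [ha, hb] with n h1 h2
  have := avg_sq_add_le (F n) x y
  linarith

theorem SquareAverageable.smul {F : ℕ → Finset G} {x : G → H} (c : ℂ)
    (hx : SquareAverageable F x) : SquareAverageable F (c • x) := by
  obtain ⟨a, ha⟩ := hx
  rw [eventually_map] at ha
  refine ⟨‖c‖ ^ 2 * a, ?_⟩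
  rw [eventually_map]
  filter_upwards [ha] with n h1
  rw [avg_sq_smul]
  exact mul_le_mul_of_nonneg_left h1 (by positivity)

theorem SquareAverageable.zero (F : ℕ → Finset G) : SquareAverageable F (0 : G → H) :=
  ⟨0, by simp [avg]⟩

theorem SquareAverageable.sub {F : ℕ → Finset G} {x y : G → H}
    (hx : SquareAverageable F x) (hy : SquareAverageable F y) : SquareAverageable F (x - y) := by
  have := hx.add (hy.smul (-1))
  rwa [neg_one_smul, ← sub_eq_add_neg] at this

theorem SquareAverageable.comp {F : ℕ → Finset G} {x : G → H} (hx : SquareAverageable F x)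
    {N : ℕ → ℕ} (hN : StrictMono N) : SquareAverageable (fun q => F (N q)) x := by
  obtain ⟨a, ha⟩ := hx
  rw [eventually_map] at ha
  exact ⟨a, by rw [eventually_map]; exact hN.tendsto_atTop.eventually ha⟩

theorem exists_lim_of_approx {A : ℕ → Finset G} {x y : G → H} (hy : SquareAverageable A y)
    (hx : ∀ ε > (0 : ℝ), ∃ x' : G → H,
      (∃ L : ℂ, Tendsto (fun q => avg (A q) (fun g => inner ℂ (x' g) (y g))) atTop (𝓝 L)) ∧
      ∀ᶠ q in atTop, avg (A q) (fun g => ‖(x - x') g‖ ^ 2) < ε) :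
    ∃ L : ℂ, Tendsto (fun q => avg (A q) (fun g => inner ℂ (x g) (y g))) atTop (𝓝 L) := by
  apply cauchySeq_tendsto_of_complete
  obtain ⟨C, hC⟩ := hy
  rw [eventually_map] at hC
  rw [Metric.cauchySeq_iff']
  intro ε hε
  have hδ : 0 < (ε / 4) ^ 2 / (|C| + 1) := by positivity
  obtain ⟨x', ⟨L, hL⟩, hx'⟩ := hx _ hδ
  have hclose : ∀ᶠ q in atTop, dist (avg (A q) (fun g => inner ℂ (x g) (y g))) L < ε / 2 := by
    filter_upwards [hC, hx', Metric.tendsto_nhds.1 hL (ε / 4) (by positivity)] with q h1 h2 h3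
    have e : avg (A q) (fun g => inner ℂ (x g) (y g)) =
        avg (A q) (fun g => inner ℂ ((x - x') g) (y g)) +
          avg (A q) (fun g => inner ℂ (x' g) (y g)) := by
      rw [← avg_inner_add_left, sub_add_cancel]
    have h4 := avg_inner_sq_le (A q) (x - x') y
    have h5 : avg (A q) (fun g => ‖(x - x') g‖ ^ 2) * avg (A q) (fun g => ‖y g‖ ^ 2) ≤
        (ε / 4) ^ 2 / (|C| + 1) * (|C| + 1) :=
      mul_le_mul h2.le (h1.trans ((le_abs_self C).trans (by linarith)))
        (avg_sq_nonneg _ _) hδ.le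
    rw [div_mul_cancel₀ _ (by positivity)] at h5
    have h6 := abs_le_of_sq_le_sq (h4.trans h5) (by positivity)
    rw [dist_eq_norm] at h3 ⊢
    rw [e, add_sub_assoc]
    have h7 := norm_add_le (avg (A q) (fun g => inner ℂ ((x - x') g) (y g)))
      (avg (A q) (fun g => inner ℂ (x' g) (y g)) - L)
    have h8 := (abs_le.1 (h6 : |_| ≤ _)).2
    linarith
  obtain ⟨n, hn⟩ := eventually_atTop.1 hclose
  refine ⟨n, fun m hm => ?_⟩
  have := dist_triangle_right (avg (A m) (fun g => inner ℂ (x g) (y g)))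
    (avg (A n) (fun g => inner ℂ (x g) (y g))) L
  linarith [hn m hm, hn n le_rfl]

end Averages

/-- A permissible pair `((f_i)_{i ∈ I}, (F_{N_q})_q)`: a family of square averageable functions and
a subsequence of `(F_n)` along which all averaged inner products of members of the family
converge. -/
structure PermissiblePair {G H I : Type*} [NormedAddCommGroup H] [InnerProductSpace ℂ H]
    (F : ℕ → Finset G) (f : I → G → H) where
  /-- the indices `N_q` -/
  N : ℕ → ℕ
  strictMono : StrictMono N
  squareAverageable : ∀ i, SquareAverageable F (f i)
  exists_lim : ∀ i j, ∃ L : ℂ,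
    Tendsto (fun q => avg (F (N q)) (fun g => inner ℂ (f i g) (f j g))) atTop (𝓝 L)

namespace PermissiblePair

variable {G H I : Type*} [NormedAddCommGroup H] [InnerProductSpace ℂ H]
  {F : ℕ → Finset G} {f : I → G → H} (P : PermissiblePair F f)

/-- The sets `F_{N_q}`. -/
def sets (q : ℕ) : Finset G := F (P.N q)

/-- The linear span `ℋ'` of the family. -/
def spanF : Submodule ℂ (G → H) := Submodule.span ℂ (Set.range f)

theorem squareAverageable_of_mem_span {x : G → H} (hx : x ∈ spanF (f := f)) :
    SquareAverageable P.sets x := by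
  induction hx using Submodule.span_induction with
  | mem x hx => obtain ⟨i, rfl⟩ := hx; exact (P.squareAverageable i).comp P.strictMono
  | zero => exact SquareAverageable.zero _
  | add x y _ _ hx hy => exact hx.add hy
  | smul c x _ hx => exact hx.smul c

/-- The functions `E` of `ℋ''`: square averageable along `(F_{N_q})`, and approximable by elements
of the span in the mean square sense. -/
def MemPre (E : G → H) : Prop :=
  SquareAverageable P.sets E ∧
    ∀ ε > (0 : ℝ), ∃ E' ∈ spanF (f := f),
      limsup (fun q => avg (P.sets q) (fun g => ‖E g - E' g‖ ^ 2)) atTop < ε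

theorem memPre_iff {E : G → H} : P.MemPre E ↔ SquareAverageable P.sets E ∧
    ∀ ε > (0 : ℝ), ∃ E' ∈ spanF (f := f),
      ∀ᶠ q in atTop, avg (P.sets q) (fun g => ‖(E - E') g‖ ^ 2) < ε := by
  refine and_congr_right fun hE => ⟨fun h ε hε => ?_, fun h ε hε => ?_⟩
  · obtain ⟨E', hE', hl⟩ := h ε hε
    exact ⟨E', hE', eventually_lt_of_limsup_lt hl
      (hE.sub (P.squareAverageable_of_mem_span hE'))⟩
  · obtain ⟨E', hE', hl⟩ := h (ε / 2) (half_pos hε)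
    refine ⟨E', hE', lt_of_le_of_lt (limsup_le_of_le ?_ (hl.mono fun q hq => hq.le))
      (half_lt_self hε)⟩
    exact IsBoundedUnder.isCoboundedUnder_le
      ⟨0, eventually_map.2 (Eventually.of_forall fun q => avg_sq_nonneg (P.sets q) (E - E'))⟩

/-- The space `ℋ''` as a space of functions. -/
def preSubmodule : Submodule ℂ (G → H) where
  carrier := {E | P.MemPre E}
  zero_mem' := (P.memPre_iff).2 ⟨SquareAverageable.zero _, fun ε hε =>
    ⟨0, Submodule.zero_mem _, Eventually.of_forall fun q => by simpa [avg] using hε⟩⟩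
  add_mem' := by
    intro x y hx hy
    rw [Set.mem_ofPred_eq, memPre_iff] at *
    refine ⟨hx.1.add hy.1, fun ε hε => ?_⟩
    obtain ⟨x', hx', h1⟩ := hx.2 (ε / 4) (by positivity)
    obtain ⟨y', hy', h2⟩ := hy.2 (ε / 4) (by positivity)
    refine ⟨x' + y', Submodule.add_mem _ hx' hy', ?_⟩
    filter_upwards [h1, h2] with q h1 h2
    have := avg_sq_add_le (P.sets q) (x - x') (y - y')
    rw [show x + y - (x' + y') = (x - x') + (y - y') by abel]
    linarith
  smul_mem' := by
    intro c x hx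
    rw [Set.mem_ofPred_eq, memPre_iff] at *
    refine ⟨hx.1.smul c, fun ε hε => ?_⟩
    obtain ⟨x', hx', h1⟩ := hx.2 (ε / (‖c‖ ^ 2 + 1)) (by positivity)
    refine ⟨c • x', Submodule.smul_mem _ c hx', ?_⟩
    filter_upwards [h1] with q h1
    rw [← smul_sub, avg_sq_smul]
    rw [lt_div_iff₀ (by positivity)] at h1
    nlinarith [avg_sq_nonneg (P.sets q) (x - x')]

theorem mem_preSubmodule (i : I) : f i ∈ P.preSubmodule :=
  (P.memPre_iff).2 ⟨(P.squareAverageable i).comp P.strictMono, fun ε hε =>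
    ⟨f i, Submodule.subset_span ⟨i, rfl⟩,
      Eventually.of_forall fun q => by simpa [avg] using hε⟩⟩

theorem exists_lim_of_mem_span {x y : G → H} (hx : x ∈ spanF (f := f)) (hy : y ∈ spanF (f := f)) :
    ∃ L : ℂ, Tendsto (fun q => avg (P.sets q) (fun g => inner ℂ (x g) (y g))) atTop (𝓝 L) := by
  induction hx using Submodule.span_induction with
  | zero => exact ⟨0, by simp [avg]⟩
  | add x x' _ _ h h' =>
    obtain ⟨L, hL⟩ := h
    obtain ⟨L', hL'⟩ := h'
    exact ⟨L + L', by simpa only [avg_inner_add_left] using hL.add hL'⟩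
  | smul c x _ h =>
    obtain ⟨L, hL⟩ := h
    exact ⟨(starRingEnd ℂ) c * L, by simpa only [avg_inner_smul_left] using hL.const_mul _⟩
  | mem x hx =>
    obtain ⟨i, rfl⟩ := hx
    suffices h : ∃ L : ℂ, Tendsto (fun q => avg (P.sets q) (fun g => inner ℂ (y g) (f i g)))
        atTop (𝓝 L) by
      obtain ⟨L, hL⟩ := h
      exact ⟨(starRingEnd ℂ) L, by
        simpa only [Function.comp_def, avg_inner_conj] using
      (Complex.continuous_conj.tendsto L).comp hL⟩
    induction hy using Submodule.span_induction with
    | zero => exact ⟨0, by simp [avg]⟩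
    | add x x' _ _ h h' =>
      obtain ⟨L, hL⟩ := h
      obtain ⟨L', hL'⟩ := h'
      exact ⟨L + L', by simpa only [avg_inner_add_left] using hL.add hL'⟩
    | smul c x _ h =>
      obtain ⟨L, hL⟩ := h
      exact ⟨(starRingEnd ℂ) c * L, by simpa only [avg_inner_smul_left] using hL.const_mul _⟩
    | mem y hy => obtain ⟨j, rfl⟩ := hy; exact P.exists_lim j i

theorem exists_lim_of_mem {x y : G → H} (hx : x ∈ P.preSubmodule) (hy : y ∈ P.preSubmodule) :
    ∃ L : ℂ, Tendsto (fun q => avg (P.sets q) (fun g => inner ℂ (x g) (y g))) atTop (𝓝 L) := by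
  have hx := P.memPre_iff.1 hx
  have hy := P.memPre_iff.1 hy
  refine exists_lim_of_approx hy.1 fun ε hε => ?_
  obtain ⟨x', hx', h1⟩ := hx.2 ε hε
  refine ⟨x', ?_, h1⟩
  have h : ∃ L : ℂ, Tendsto (fun q => avg (P.sets q) (fun g => inner ℂ (y g) (x' g)))
      atTop (𝓝 L) := by
    refine exists_lim_of_approx (P.squareAverageable_of_mem_span hx') fun δ hδ => ?_
    obtain ⟨y', hy', h2⟩ := hy.2 δ hδ
    exact ⟨y', P.exists_lim_of_mem_span hy' hx', h2⟩
  obtain ⟨L, hL⟩ := h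
  exact ⟨(starRingEnd ℂ) L, by
    simpa only [Function.comp_def, avg_inner_conj] using
      (Complex.continuous_conj.tendsto L).comp hL⟩

/-- The space `ℋ''`, as a type that carries no topology from the product `G → H`. -/
def Pre : Type _ := P.preSubmodule

instance : AddCommGroup P.Pre := inferInstanceAs (AddCommGroup P.preSubmodule)

instance : Module ℂ P.Pre := inferInstanceAs (Module ℂ P.preSubmodule)

/-- An element of `ℋ''` from a function that belongs to it. -/
def Pre.mk {P : PermissiblePair F f} (x : G → H) (hx : x ∈ P.preSubmodule) : P.Pre :=
  (⟨x, hx⟩ : P.preSubmodule)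

/-- The function `G → H` underlying an element of `ℋ''`. -/
def Pre.toFun {P : PermissiblePair F f} (x : P.Pre) : G → H :=
  Subtype.val (p := (· ∈ P.preSubmodule)) x

/-- The form `⟨x, y⟩_ℋ = lim_q (1/|F_{N_q}|) ∑_{g ∈ F_{N_q}} ⟨x g, y g⟩` on `ℋ''`. -/
def preInner (x y : P.Pre) : ℂ :=
  limUnder atTop (fun q => avg (P.sets q) (fun g => inner ℂ (x.toFun g) (y.toFun g)))

theorem tendsto_preInner (x y : P.Pre) :
    Tendsto (fun q => avg (P.sets q) (fun g => inner ℂ (x.toFun g) (y.toFun g))) atTop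
      (𝓝 (P.preInner x y)) :=
  tendsto_nhds_limUnder (P.exists_lim_of_mem x.2 y.2)

/-- `⟨·,·⟩_ℋ` is a positive semidefinite Hermitian form on `ℋ''`. -/
@[reducible]
def preCore : PreInnerProductSpace.Core ℂ P.Pre where
  inner := P.preInner
  conj_inner_symm x y := by
    refine tendsto_nhds_unique ?_ (P.tendsto_preInner x y)
    simpa only [Function.comp_def, avg_inner_conj] using
      (Complex.continuous_conj.tendsto _).comp (P.tendsto_preInner y x)
  re_inner_nonneg x := by
    refine ge_of_tendsto ((Complex.continuous_re.tendsto _).comp (P.tendsto_preInner x x))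
      (Eventually.of_forall fun q => ?_)
    simp only [Function.comp_apply, avg_inner_self, Complex.ofReal_re]
    exact avg_sq_nonneg _ _
  add_left x y z := by
    refine tendsto_nhds_unique (P.tendsto_preInner (x + y) z) ?_
    have h := (P.tendsto_preInner x z).add (P.tendsto_preInner y z)
    simp only [← avg_inner_add_left] at h
    exact h
  smul_left x y c := by
    refine tendsto_nhds_unique (P.tendsto_preInner (c • x) y) ?_
    have h := (P.tendsto_preInner x y).const_mul ((starRingEnd ℂ) c)
    simp only [← avg_inner_smul_left] at h
    exact h

instance : SeminormedAddCommGroup P.Pre :=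
  @InnerProductSpace.Core.toSeminormedAddCommGroup ℂ P.Pre _ _ _ P.preCore

instance : InnerProductSpace ℂ P.Pre := InnerProductSpace.ofCore P.preCore

/-- The space `ℋ = ℋ'' / S` induced by the permissible pair, `S` being the null space of the
seminorm `‖x‖² = lim_q (1/|F_{N_q}|) ∑_{g ∈ F_{N_q}} ‖x g‖²`. -/
abbrev Space : Type _ := SeparationQuotient P.Pre

/-- The class in `ℋ` of an element of `ℋ''`. -/
def toSpace (x : P.Pre) : P.Space := SeparationQuotient.mk x

theorem inner_toSpace (x y : P.Pre) : inner ℂ (P.toSpace x) (P.toSpace y) = P.preInner x y := rfl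

/-- The subspace divided out consists of the `x` with `lim_q (1/|F_{N_q}|) ∑_{g ∈ F_{N_q}} ‖x g‖² = 0`. -/
theorem toSpace_eq_zero_iff (x : P.Pre) : P.toSpace x = 0 ↔
    Tendsto (fun q => avg (P.sets q) (fun g => ‖x.toFun g‖ ^ 2)) atTop (𝓝 0) := by
  have h := P.tendsto_preInner x x
  simp only [avg_inner_self] at h
  rw [← inner_self_eq_zero (𝕜 := ℂ), inner_toSpace]
  constructor
  · intro h0
    rw [h0] at h
    simpa [Function.comp_def] using (Complex.continuous_re.tendsto _).comp h
  · intro h0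
    exact tendsto_nhds_unique h (by
      simpa [Function.comp_def] using (Complex.continuous_ofReal.tendsto 0).comp h0)

/-- The class in `ℋ` of the member `f i` of the family. -/
def cls (i : I) : P.Space := P.toSpace (Pre.mk (f i) (P.mem_preSubmodule i))

end PermissiblePair

section Representations

/-- `π` is unitarily equivalent to a subrepresentation of `ρ`, i.e. to the restriction of `ρ` to a
closed invariant subspace. -/
def EquivSubrepresentation {G E E' : Type*} [Group G]
    [NormedAddCommGroup E] [InnerProductSpace ℂ E] [NormedAddCommGroup E'] [InnerProductSpace ℂ E']
    (π : G →* (E ≃ₗᵢ[ℂ] E)) (ρ : G →* (E' ≃ₗᵢ[ℂ] E')) : Prop :=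
  ∃ K : Submodule ℂ E', IsClosed (K : Set E') ∧ (∀ g, ∀ x ∈ K, ρ g x ∈ K) ∧
    ∃ Φ : E ≃ₗᵢ[ℂ] K, ∀ g x, (Φ (π g x) : E') = ρ g (Φ x)

variable (G : Type*) [Group G]

/-- `ℓ²(G)` -/
abbrev L2 : Type _ := lp (fun _ : G => ℂ) 2

variable {G}

theorem memlp_leftTranslate (g : G) (x : L2 G) : Memℓp (fun k => x (g⁻¹ * k)) 2 := by
  have h := (memℓp_gen_iff (p := 2) (by norm_num)).1 x.2
  exact (memℓp_gen_iff (p := 2) (by norm_num)).2 ((Equiv.mulLeft g⁻¹).summable_iff.2 h)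

/-- `(L_g x)(k) = x (g⁻¹ k)` on `ℓ²(G)`. -/
def leftTranslate (g : G) (x : L2 G) : L2 G := ⟨fun k => x (g⁻¹ * k), memlp_leftTranslate g x⟩

@[simp]
theorem leftTranslate_apply (g : G) (x : L2 G) (k : G) : leftTranslate g x k = x (g⁻¹ * k) := rfl

/-- `L_g` as a unitary operator of `ℓ²(G)`. -/
def leftTranslateIsometry (g : G) : L2 G ≃ₗᵢ[ℂ] L2 G where
  toFun := leftTranslate g
  invFun := leftTranslate g⁻¹
  left_inv x := by ext k; simp
  right_inv x := by ext k; simp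
  map_add' x y := by ext k; simp
  map_smul' c x := by ext k; simp
  norm_map' x := by
    change ‖leftTranslate g x‖ = ‖x‖
    rw [lp.norm_eq_tsum_rpow (p := 2) (by norm_num), lp.norm_eq_tsum_rpow (p := 2) (by norm_num)]
    congr 1
    exact (Equiv.mulLeft g⁻¹).tsum_eq (fun k => ‖x k‖ ^ (2 : ENNReal).toReal)

variable (G) in
/-- The left regular representation of `G` on `ℓ²(G)`. -/
def leftRegular : G →* (L2 G ≃ₗᵢ[ℂ] L2 G) where
  toFun := leftTranslateIsometry
  map_one' := by
    refine LinearIsometryEquiv.ext fun x => ?_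
    ext k
    change x (1⁻¹ * k) = x k
    simp
  map_mul' g h := by
    refine LinearIsometryEquiv.ext fun x => ?_
    ext k
    change x ((g * h)⁻¹ * k) = x (h⁻¹ * (g⁻¹ * k))
    simp [mul_assoc]

variable {H : Type*} [NormedAddCommGroup H] [InnerProductSpace ℂ H]

/-- `(U_h u)(g) = u (g h)`. -/
def translate (h : G) (u : G → H) : G → H := fun g => u (g * h)

/-- `U` is the unitary representation induced on `ℋ` by the translations: `U_g` sends the class of
`U_h u` to the class of `U_g U_h u = U_{gh} u`. (The classes of the `U_h u` span a dense subspace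
of `ℋ`, so this determines `U`.) -/
def IsInducedRep {F : ℕ → Finset G} {u : G → H}
    (P : PermissiblePair F (fun h : G => translate h u))
    (U : G →* (P.Space ≃ₗᵢ[ℂ] P.Space)) : Prop :=
  ∀ g h, U g (P.cls h) = P.cls (g * h)

/-- `u` is spectrally Lebesgue: for every permissible pair `((U_h u)_{h ∈ G}, (F_{N_q})_q)`, the
translations induce a (unique) unitary representation on `ℋ`, and it is equivalent to a
subrepresentation of the left regular representation. -/
def SpectrallyLebesgue (F : ℕ → Finset G) (u : G → H) : Prop :=
  ∀ P : PermissiblePair F (fun h : G => translate h u),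
    (∃! U : G →* (P.Space ≃ₗᵢ[ℂ] P.Space), IsInducedRep P U) ∧
    ∀ U : G →* (P.Space ≃ₗᵢ[ℂ] P.Space), IsInducedRep P U →
      EquivSubrepresentation U (leftRegular G)

end Representations

end

end VdC

/-! Fix a permissible pair. The Følner property and boundedness of `u` make the Gram matrix of the
classes of the `U_h u` invariant under left translation of the index (`inner_cls_mul`). These
classes span a dense subspace, so the translations extend uniquely to a unitary representation once
`P.Space` is complete. Completeness (`completeSpace_pre`) comes from patching a Cauchy sequence of
functions into one function, which works because `|F_n| → ∞`.

The class `v` of `u` is cyclic, and `⟨v, U_h v⟩` is a limit of correlation averages along a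
subsequence, so its square is at most the corresponding limsup. The hypothesis thus says that the
diagonal coefficient of `v` is square summable.

It remains to embed such a representation in `ℓ²(G)` (`equivSubrepresentation_leftRegular`). The map
`x ↦ (g ↦ ⟨U_g v, x⟩)` is closed, injective, densely defined and equivariant, but possibly
unbounded. It is therefore replaced by its graph, a Hilbert space with bounded equivariant
projections to both factors. Polar decomposition (`exists_isometric_intertwiner`) of the adjoint of
one projection and of the other projection yields isometries from `ℋ` to the graph and from the
graph to `ℓ²(G)`. -/

namespace VdC

/-! ### Cardinality and asymptotic invariance of Følner sets -/

section Folner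

variable {G : Type*} [Group G]

/-- A set `F n` with at most `M` elements whose relative boundary is below `1 / (M + 1)` for each of
`M + 1` elements `g` has empty boundary for each of them. It then contains `a * g` for all these
`g`, which is too many points. -/
theorem IsRightFolner.eventually_lt_card [Infinite G] {F : ℕ → Finset G} (hF : IsRightFolner F)
    (M : ℕ) : ∀ᶠ n in atTop, M < (F n).card := by
  classical
  obtain ⟨S, hS⟩ := Infinite.exists_subset_card_eq G (M + 1)
  have h : ∀ᶠ n in atTop, ∀ g ∈ S,
      ((symmDiff (F n : Set G) ((fun x => x * g) '' (F n : Set G))).ncard : ℝ) /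
        ((F n).card : ℝ) < 1 / (M + 1) :=
    (Finset.eventually_all S).2 fun g _ => (hF.2 g).eventually_lt_const (by positivity)
  filter_upwards [h] with n hn
  by_contra! hle
  obtain ⟨a, ha⟩ := hF.1 n
  have hpos : (0 : ℝ) < (F n).card := by exact_mod_cast Finset.card_pos.2 (hF.1 n)
  have hmem : ∀ g ∈ S, a * g ∈ F n := by
    intro g hg
    have h1 := hn g hg
    rw [div_lt_div_iff₀ hpos (by positivity)] at h1
    have hM : ((F n).card : ℝ) ≤ M := by exact_mod_cast hle
    have h2 : ((symmDiff (F n : Set G) ((fun x => x * g) '' (F n : Set G))).ncard : ℝ) < 1 := by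
      by_contra! h3
      nlinarith
    have h4 : (symmDiff (F n : Set G) ((fun x => x * g) '' (F n : Set G))).ncard = 0 := by
      exact_mod_cast Nat.lt_one_iff.1 (by exact_mod_cast h2)
    rw [Set.ncard_eq_zero (((F n).finite_toSet).symmDiff ((F n).finite_toSet.image _))] at h4
    have h5 := symmDiff_eq_bot.1 h4
    have h6 : a * g ∈ (F n : Set G) := h5 ▸ ⟨a, ha, rfl⟩
    exact h6
  have := Finset.card_le_card_of_injOn (fun g => a * g) hmem (fun x _ y _ h => mul_left_cancel h)
  omega

theorem IsRightFolner.tendsto_card [Infinite G] {F : ℕ → Finset G} (hF : IsRightFolner F) :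
    Tendsto (fun n => (F n).card) atTop atTop :=
  tendsto_atTop.2 fun M => (hF.eventually_lt_card M).mono fun _ h => h.le

/-- The translated sum is a sum over the translated set; the terms on the overlap cancel and only
the symmetric difference remains. -/
theorem norm_sum_translate_sub_le (A : Finset G) (g : G) {φ : G → ℂ} {C : ℝ}
    (hφ : ∀ x, ‖φ x‖ ≤ C) :
    ‖∑ x ∈ A, φ (x * g) - ∑ x ∈ A, φ x‖ ≤
      C * ((symmDiff (A : Set G) ((fun x => x * g) '' (A : Set G))).ncard : ℝ) := by
  classical
  set B : Finset G := A.image (fun x => x * g) with hB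
  have h1 : ∑ x ∈ A, φ (x * g) = ∑ x ∈ B, φ x :=
    (Finset.sum_image (fun x _ y _ h => mul_right_cancel h)).symm
  have h2 : (symmDiff (A : Set G) ((fun x => x * g) '' (A : Set G))).ncard = (symmDiff A B).card := by
    rw [← Set.ncard_coe_finset, Finset.coe_symmDiff, hB, Finset.coe_image]
  have h3 : ∑ x ∈ B, φ x - ∑ x ∈ A, φ x = ∑ x ∈ B \ A, φ x - ∑ x ∈ A \ B, φ x := by
    rw [← Finset.sum_inter_add_sum_sdiff B A, ← Finset.sum_inter_add_sum_sdiff A B,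
      Finset.inter_comm A B]
    ring
  have h4 : (symmDiff A B).card = (A \ B).card + (B \ A).card := by
    rw [symmDiff_def, Finset.sup_eq_union, Finset.card_union_of_disjoint]
    exact disjoint_sdiff_sdiff
  have h5 : ∀ D : Finset G, ‖∑ x ∈ D, φ x‖ ≤ C * D.card := fun D => by
    have := norm_sum_le_of_le D (f := φ) (n := fun _ => C) (fun x _ => hφ x)
    simpa [mul_comm] using this
  rw [h1, h2, h3, h4]
  push_cast
  have := norm_sub_le (∑ x ∈ B \ A, φ x) (∑ x ∈ A \ B, φ x)
  linarith [h5 (B \ A), h5 (A \ B)]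

theorem IsRightFolner.tendsto_avg_translate_sub {F : ℕ → Finset G} (hF : IsRightFolner F) (g : G)
    {φ : G → ℂ} {C : ℝ} (hφ : ∀ x, ‖φ x‖ ≤ C) :
    Tendsto (fun n => avg (F n) (fun x => φ (x * g)) - avg (F n) φ) atTop (𝓝 0) := by
  have h := (hF.2 g).const_mul C
  rw [mul_zero] at h
  refine squeeze_zero_norm (fun n => ?_) h
  rw [avg, avg, ← smul_sub, norm_smul, norm_inv, Real.norm_natCast, div_eq_inv_mul,
    mul_left_comm]
  exact mul_le_mul_of_nonneg_left (norm_sum_translate_sub_le _ _ hφ) (by positivity)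

end Folner

/-! ### Patching mean-square Cauchy sequences of functions -/

section Patching

variable {G H : Type*} [NormedAddCommGroup H] [InnerProductSpace ℂ H]

/-- The union of the first `a` sets of a sequence. -/
noncomputable def initialUnion (A : ℕ → Finset G) (a : ℕ) : Finset G := by
  classical exact (Finset.range a).biUnion A

theorem mem_initialUnion {A : ℕ → Finset G} {a : ℕ} {g : G} :
    g ∈ initialUnion A a ↔ ∃ p < a, g ∈ A p := by
  simp [initialUnion]

/-- Times `q 0 < q 1 < ...` at which one may pass from `x k` to `x (k + 1)` when patching. -/
theorem exists_switching_times {A : ℕ → Finset G} (hA : Tendsto (fun q => (A q).card) atTop atTop)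
    {x : ℕ → G → H} {δ : ℕ → ℝ} (hδ : ∀ j, 0 < δ j)
    (hx : ∀ j k, j ≤ k → ∀ᶠ q in atTop, avg (A q) (fun g => ‖x k g - x j g‖ ^ 2) < δ j) :
    ∃ q : ℕ → ℕ, StrictMono q ∧ ∀ k, ∀ p, q (k + 1) ≤ p → ∀ j ≤ k,
      avg (A p) (fun g => ‖x k g - x j g‖ ^ 2) < δ j ∧
      avg (A p) (fun g => ‖x (k + 1) g - x j g‖ ^ 2) < δ j ∧
      ∑ g ∈ initialUnion A (q k), ∑ i ∈ Finset.range (k + 2), ‖x i g - x j g‖ ^ 2 ≤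
        δ j * (A p).card := by
  have step : ∀ k a : ℕ, ∃ b, a < b ∧ ∀ p, b ≤ p → ∀ j ≤ k,
      avg (A p) (fun g => ‖x k g - x j g‖ ^ 2) < δ j ∧
      avg (A p) (fun g => ‖x (k + 1) g - x j g‖ ^ 2) < δ j ∧
      ∑ g ∈ initialUnion A a, ∑ i ∈ Finset.range (k + 2), ‖x i g - x j g‖ ^ 2 ≤
        δ j * (A p).card := by
    intro k a
    have h : ∀ᶠ p in atTop, ∀ j ∈ Finset.Iic k,
        avg (A p) (fun g => ‖x k g - x j g‖ ^ 2) < δ j ∧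
        avg (A p) (fun g => ‖x (k + 1) g - x j g‖ ^ 2) < δ j ∧
        ∑ g ∈ initialUnion A a, ∑ i ∈ Finset.range (k + 2), ‖x i g - x j g‖ ^ 2 ≤
          δ j * (A p).card := by
      refine (Finset.eventually_all _).2 fun j hj => ?_
      have hj : j ≤ k := Finset.mem_Iic.1 hj
      refine (hx j k hj).and ((hx j (k + 1) (by omega)).and ?_)
      -- The left-hand sum does not depend on `p`, whereas the cardinality of `A p` tends to
      -- infinity.
      exact ((tendsto_natCast_atTop_atTop.comp hA).const_mul_atTop (hδ j)).eventually_ge_atTop _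
    obtain ⟨b, hb⟩ := eventually_atTop.1 h
    exact ⟨max b (a + 1), by omega, fun p hp j hj =>
      hb p ((le_max_left _ _).trans hp) j (Finset.mem_Iic.2 hj)⟩
  choose b hab hb using step
  let q : ℕ → ℕ := fun n => Nat.rec 0 (fun k a => b k a) n
  exact ⟨q, strictMono_nat_of_lt_succ fun k => hab k (q k), fun k => hb k (q k)⟩

/-- A sequence of functions that is Cauchy in the mean-square sense along sets of cardinality
tending to infinity can be patched into a mean-square limit. -/
theorem exists_meanSquare_limit {A : ℕ → Finset G}
    (hA : Tendsto (fun q => (A q).card) atTop atTop)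
    {x : ℕ → G → H} {δ : ℕ → ℝ} (hδ : ∀ j, 0 < δ j)
    (hx : ∀ j k, j ≤ k → ∀ᶠ q in atTop, avg (A q) (fun g => ‖x k g - x j g‖ ^ 2) < δ j) :
    ∃ y : G → H, ∀ j, ∀ᶠ q in atTop, avg (A q) (fun g => ‖(y - x j) g‖ ^ 2) ≤ 3 * δ j := by
  classical
  obtain ⟨q, hq, hR⟩ := exists_switching_times hA hδ hx
  -- The limit uses `x k` at the points that first appear in block `k`. For `q (k + 1) ≤ p < q (k +
  -- 2)`, the points of `A p` have `κ` equal to `k` or `k + 1`, except for those already in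
  -- `initialUnion A (q k)`, which are negligible. Points in no `A p` get the harmless value `sInf ∅
  -- = 0`.
  let κ : G → ℕ := fun g => sInf {k | g ∈ initialUnion A (q (k + 1))}
  refine ⟨fun g => x (κ g) g, fun j => ?_⟩
  filter_upwards [eventually_ge_atTop (q (j + 1)), hA.eventually_gt_atTop 0] with p hp hcard
  have hex : ∃ m, p < q m := ⟨p + 1, (Nat.lt_succ_self p).trans_le (hq.le_apply)⟩
  obtain ⟨k, hk⟩ : ∃ k, Nat.find hex = k + 2 := by
    have h1 : q (j + 1) < q (Nat.find hex) := hp.trans_lt (Nat.find_spec hex)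
    have h2 := hq.lt_iff_lt.1 h1
    exact ⟨Nat.find hex - 2, by omega⟩
  have hp1 : p < q (k + 2) := hk ▸ Nat.find_spec hex
  have hp0 : q (k + 1) ≤ p := not_lt.1 (Nat.find_min hex (by omega))
  have hjk : j ≤ k := by
    have := hq.lt_iff_lt.1 (hp.trans_lt hp1)
    omega
  obtain ⟨r1, r2, r3⟩ := hR k p hp0 j hjk
  have hκ1 : ∀ g ∈ A p, κ g ≤ k + 1 := fun g hg =>
    Nat.sInf_le (mem_initialUnion.2 ⟨p, hp1, hg⟩)
  have hκ0 : ∀ g ∈ A p, g ∉ initialUnion A (q k) → k ≤ κ g := by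
    intro g hg hgk
    by_contra! hlt
    have hm : g ∈ initialUnion A (q (κ g + 1)) :=
      Nat.sInf_mem (s := {k | g ∈ initialUnion A (q (k + 1))})
        ⟨k + 1, mem_initialUnion.2 ⟨p, hp1, hg⟩⟩
    obtain ⟨p', hp', hg'⟩ := mem_initialUnion.1 hm
    exact hgk (mem_initialUnion.2 ⟨p', hp'.trans_le (hq.monotone hlt), hg'⟩)
  -- Each of the three terms contributes at most `δ j` to the average, whence the factor 3. For old
  -- points the unknown index `κ g` is handled by summing over all possible indices.
  have hpt : ∀ g ∈ A p, ‖x (κ g) g - x j g‖ ^ 2 ≤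
      (if g ∈ initialUnion A (q k) then ∑ i ∈ Finset.range (k + 2), ‖x i g - x j g‖ ^ 2 else 0) +
        ‖x k g - x j g‖ ^ 2 + ‖x (k + 1) g - x j g‖ ^ 2 := by
    intro g hg
    have n1 := sq_nonneg ‖x k g - x j g‖
    have n2 := sq_nonneg ‖x (k + 1) g - x j g‖
    split_ifs with h
    · have := Finset.single_le_sum (f := fun i => ‖x i g - x j g‖ ^ 2)
        (fun i _ => sq_nonneg _) (Finset.mem_range.2 (show κ g < k + 2 by have := hκ1 g hg; omega))
      linarith
    · have h0 := hκ0 g hg h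
      have h1 := hκ1 g hg
      obtain h2 | h2 : κ g = k ∨ κ g = k + 1 := by omega
      · rw [h2]; linarith
      · rw [h2]; linarith
  have hsum := Finset.sum_le_sum hpt
  rw [Finset.sum_add_distrib, Finset.sum_add_distrib, ← Finset.sum_filter] at hsum
  have hsub : ∑ g ∈ (A p).filter (· ∈ initialUnion A (q k)),
      ∑ i ∈ Finset.range (k + 2), ‖x i g - x j g‖ ^ 2 ≤ δ j * (A p).card :=
    (Finset.sum_le_sum_of_subset_of_nonneg (fun g hg => (Finset.mem_filter.1 hg).2)
      fun g _ _ => Finset.sum_nonneg fun i _ => sq_nonneg _).trans r3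
  have hpos : (0 : ℝ) < (A p).card := by exact_mod_cast hcard
  simp only [avg, smul_eq_mul, inv_mul_lt_iff₀ hpos, inv_mul_le_iff₀ hpos, Pi.sub_apply] at r1 r2 ⊢
  linarith

end Patching

/-! ### Completeness of the space of a permissible pair, and density of the span -/

namespace PermissiblePair

variable {G H I : Type*} [NormedAddCommGroup H] [InnerProductSpace ℂ H]
  {F : ℕ → Finset G} {f : I → G → H} (P : PermissiblePair F f)

theorem tendsto_avg_norm_sq (x : P.Pre) :
    Tendsto (fun q => avg (P.sets q) (fun g => ‖x.toFun g‖ ^ 2)) atTop (𝓝 (‖x‖ ^ 2)) := by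
  have h := (Complex.continuous_re.tendsto _).comp (P.tendsto_preInner x x)
  simp only [Function.comp_def, avg_inner_self, Complex.ofReal_re] at h
  have e : (P.preInner x x).re = ‖x‖ ^ 2 := (norm_sq_eq_re_inner (𝕜 := ℂ) x).symm
  rwa [e] at h

/-- The patched function stays in `ℋ''`: it is close to some `x j`, which is close to the span. -/
theorem completeSpace_pre (hF : Tendsto (fun n => (F n).card) atTop atTop) :
    CompleteSpace P.Pre := by
  refine Metric.complete_of_convergent_controlled_sequences (fun n => (1 / 2 : ℝ) ^ n)
    (fun n => by positivity) fun x hx => ?_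
  have hA : Tendsto (fun q => (P.sets q).card) atTop atTop := hF.comp P.strictMono.tendsto_atTop
  have hδ : ∀ j : ℕ, (0 : ℝ) < ((1 / 2 : ℝ) ^ j) ^ 2 := fun j => by positivity
  obtain ⟨y, hy⟩ := exists_meanSquare_limit hA (x := fun n => (x n).toFun) hδ fun j k hjk => by
    refine (P.tendsto_avg_norm_sq (x k - x j)).eventually_lt_const ?_
    rw [← dist_eq_norm]
    exact pow_lt_pow_left₀ (hx j k j hjk le_rfl) dist_nonneg two_ne_zero
  have hlim : Tendsto (fun j : ℕ => 3 * ((1 / 2 : ℝ) ^ j) ^ 2) atTop (𝓝 0) := by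
    have := ((tendsto_pow_atTop_nhds_zero_of_lt_one (r := (1 / 2 : ℝ)) (by norm_num)
      (by norm_num)).pow 2).const_mul 3
    simpa using this
  have hymem : y ∈ P.preSubmodule := by
    refine P.memPre_iff.2 ⟨?_, fun ε hε => ?_⟩
    · have h0 : SquareAverageable P.sets (y - (x 0).toFun) := ⟨_, eventually_map.2 (hy 0)⟩
      have h1 : SquareAverageable P.sets (x 0).toFun := (P.memPre_iff.1 (x 0).2).1
      simpa using h0.add h1
    -- `avg_sq_add_le` doubles both errors, hence `ε / 4` for each.
    · obtain ⟨j, hj⟩ := (hlim.eventually_lt_const (show (0 : ℝ) < ε / 4 by positivity)).exists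
      obtain ⟨E', hE', h1⟩ := (P.memPre_iff.1 (x j).2).2 (ε / 4) (by positivity)
      refine ⟨E', hE', ?_⟩
      filter_upwards [h1, hy j] with q h1 h2
      have h3 := avg_sq_add_le (P.sets q) (y - (x j).toFun) ((x j).toFun - E')
      rw [sub_add_sub_cancel] at h3
      have h1' : avg (P.sets q) (fun g => ‖((x j).toFun - E') g‖ ^ 2) < ε / 4 := h1
      linarith
  refine ⟨Pre.mk y hymem, ?_⟩
  rw [tendsto_iff_norm_sub_tendsto_zero]
  have hb : ∀ j, ‖x j - Pre.mk y hymem‖ ^ 2 ≤ 3 * ((1 / 2 : ℝ) ^ j) ^ 2 := fun j => by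
    rw [norm_sub_rev]
    exact le_of_tendsto (P.tendsto_avg_norm_sq (Pre.mk y hymem - x j)) (hy j)
  have h := (squeeze_zero (fun j => sq_nonneg _) hb hlim).sqrt
  simpa using h

theorem completeSpace_space (hF : Tendsto (fun n => (F n).card) atTop atTop) :
    CompleteSpace P.Space := by
  have := P.completeSpace_pre hF
  infer_instance

theorem spanF_le_preSubmodule : spanF (f := f) ≤ P.preSubmodule :=
  Submodule.span_le.2 (by rintro _ ⟨i, rfl⟩; exact P.mem_preSubmodule i)

theorem toSpace_mem_span_cls {x : G → H} (hx : x ∈ P.preSubmodule) (hs : x ∈ spanF (f := f)) :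
    P.toSpace (Pre.mk x hx) ∈ Submodule.span ℂ (Set.range P.cls) := by
  induction hs using Submodule.span_induction with
  | mem x h => obtain ⟨i, rfl⟩ := h; exact Submodule.subset_span ⟨i, rfl⟩
  | zero => exact Submodule.zero_mem _
  | add a b ha hb iha ihb =>
    exact Submodule.add_mem _ (iha (P.spanF_le_preSubmodule ha)) (ihb (P.spanF_le_preSubmodule hb))
  | smul c a ha iha =>
    exact Submodule.smul_mem _ c (iha (P.spanF_le_preSubmodule ha))

theorem dense_span_cls : Dense (Submodule.span ℂ (Set.range P.cls) : Set P.Space) := by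
  intro z
  obtain ⟨x, rfl⟩ := SeparationQuotient.surjective_mk z
  rw [Metric.mem_closure_iff]
  intro ε hε
  obtain ⟨E', hE', h⟩ := (P.memPre_iff.1 x.2).2 ((ε / 2) ^ 2) (by positivity)
  refine ⟨_, P.toSpace_mem_span_cls (P.spanF_le_preSubmodule hE') hE', ?_⟩
  have h1 : ‖x - Pre.mk E' (P.spanF_le_preSubmodule hE')‖ ^ 2 ≤ (ε / 2) ^ 2 :=
    le_of_tendsto (P.tendsto_avg_norm_sq (x - Pre.mk E' (P.spanF_le_preSubmodule hE'))) (h.mono fun q hq => hq.le)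
  have h2 := abs_le_of_sq_le_sq h1 (by positivity)
  change dist x (Pre.mk E' (P.spanF_le_preSubmodule hE')) < ε
  rw [dist_eq_norm]
  linarith [(abs_le.1 h2).2]

end PermissiblePair

/-! ### Isometries and representations determined by Gram matrices -/

section Extension

variable {ι E E' : Type*} [NormedAddCommGroup E] [InnerProductSpace ℂ E]
  [NormedAddCommGroup E'] [InnerProductSpace ℂ E']

/-- A linear map that has the same norms as a linear map with dense range factors through the
latter by a linear isometry. -/
theorem exists_linearIsometry_of_norm_eq [CompleteSpace E'] {V : Type*} [AddCommGroup V]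
    [Module ℂ V] (e : V →ₗ[ℂ] E) (f : V →ₗ[ℂ] E') (he : DenseRange e) (h : ∀ x, ‖f x‖ = ‖e x‖) :
    ∃ T : E →ₗᵢ[ℂ] E', ∀ x, T (e x) = f x := by
  have hn : ∃ C : ℝ, ∀ x, ‖f x‖ ≤ C * ‖e x‖ := ⟨1, fun x => by rw [h, one_mul]⟩
  have hT := LinearMap.extendOfNorm_eq he hn
  refine ⟨⟨(f.extendOfNorm e).toLinearMap, fun x => ?_⟩, hT⟩
  refine congrFun (he.equalizer (g := fun x => ‖f.extendOfNorm e x‖) (h := fun x => ‖x‖)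
    (by fun_prop) (by fun_prop) (funext fun x => ?_)) x
  simp [hT, h]

theorem norm_linearCombination_eq {v : ι → E} {w : ι → E'}
    (h : ∀ i j, inner ℂ (v i) (v j) = inner ℂ (w i) (w j)) (c : ι →₀ ℂ) :
    ‖Finsupp.linearCombination ℂ w c‖ = ‖Finsupp.linearCombination ℂ v c‖ := by
  have hi : inner ℂ (Finsupp.linearCombination ℂ w c) (Finsupp.linearCombination ℂ w c) =
      inner ℂ (Finsupp.linearCombination ℂ v c) (Finsupp.linearCombination ℂ v c) := by
    simp only [Finsupp.linearCombination_apply, Finsupp.sum, sum_inner, inner_sum,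
      inner_smul_left, inner_smul_right, h]
  rw [norm_eq_sqrt_re_inner (𝕜 := ℂ), hi, ← norm_eq_sqrt_re_inner]

/-- Families with the same Gram matrix are related by an isometry. -/
theorem exists_linearIsometry_of_inner_eq [CompleteSpace E'] {v : ι → E} {w : ι → E'}
    (hv : Dense (Submodule.span ℂ (Set.range v) : Set E))
    (h : ∀ i j, inner ℂ (v i) (v j) = inner ℂ (w i) (w j)) :
    ∃ T : E →ₗᵢ[ℂ] E', ∀ i, T (v i) = w i := by
  obtain ⟨T, hT⟩ := exists_linearIsometry_of_norm_eq (Finsupp.linearCombination ℂ v)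
    (Finsupp.linearCombination ℂ w)
    (by rwa [DenseRange, ← LinearMap.coe_range, Finsupp.range_linearCombination])
    (norm_linearCombination_eq h)
  exact ⟨T, fun i => by simpa using hT (Finsupp.single i 1)⟩

theorem linearIsometry_eq_of_dense_span {v : ι → E}
    (hv : Dense (Submodule.span ℂ (Set.range v) : Set E)) {S T : E →ₗᵢ[ℂ] E'}
    (h : ∀ i, S (v i) = T (v i)) : S = T := by
  have : S.toContinuousLinearMap = T.toContinuousLinearMap :=
    ContinuousLinearMap.ext_on hv (by rintro _ ⟨i, rfl⟩; exact h i)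
  ext x
  exact DFunLike.congr_fun this x

/-- If the Gram matrix of `v : G → E` is invariant under left translation and `v` spans a dense
subspace, then left translation of the index induces a unitary representation on `E`. -/
theorem existsUnique_rep_of_inner_eq {G : Type*} [Group G] [CompleteSpace E] {v : G → E}
    (hv : Dense (Submodule.span ℂ (Set.range v) : Set E))
    (h : ∀ g i j, inner ℂ (v (g * i)) (v (g * j)) = inner ℂ (v i) (v j)) :
    ∃! U : G →* (E ≃ₗᵢ[ℂ] E), ∀ g i, U g (v i) = v (g * i) := by
  choose T hT using fun g => exists_linearIsometry_of_inner_eq (w := fun i => v (g * i)) hv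
    fun i j => (h g i j).symm
  -- Both sides agree on the vectors `v i`. Multiplicativity also gives surjectivity, since `T g⁻¹`
  -- inverts `T g`.
  have hmul : ∀ a b, (T a).comp (T b) = T (a * b) := fun a b =>
    linearIsometry_eq_of_dense_span hv fun i => by simp [hT, mul_assoc]
  have hone : T 1 = LinearIsometry.id := linearIsometry_eq_of_dense_span hv fun i => by simp [hT]
  have hinv : ∀ a b, a * b = 1 → ∀ x, T a (T b x) = x := fun a b hab x => by
    have := DFunLike.congr_fun (hmul a b) x
    rwa [hab, hone] at this
  let U : G →* (E ≃ₗᵢ[ℂ] E) :=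
    { toFun := fun g =>
        { toLinearEquiv := LinearEquiv.ofLinearMap (T g).toLinearMap (T g⁻¹).toLinearMap
            (LinearMap.ext fun x => hinv _ _ (mul_inv_cancel g) x)
            (LinearMap.ext fun x => hinv _ _ (inv_mul_cancel g) x)
          norm_map' := fun x => (T g).norm_map x }
      map_one' := LinearIsometryEquiv.ext fun x => DFunLike.congr_fun hone x
      map_mul' := fun a b => LinearIsometryEquiv.ext fun x =>
        (DFunLike.congr_fun (hmul a b) x).symm }
  refine ⟨U, fun g i => hT g i, fun U' hU' => MonoidHom.ext fun g => ?_⟩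
  have : (U' g).toLinearIsometry = T g :=
    linearIsometry_eq_of_dense_span hv fun i => by simp [hU', hT]
  exact LinearIsometryEquiv.ext fun x => DFunLike.congr_fun this x

end Extension

/-! ### Polar decomposition of equivariant operators -/

section Intertwiners

variable {G E E' : Type*} [Group G] [NormedAddCommGroup E] [InnerProductSpace ℂ E]
  [NormedAddCommGroup E'] [InnerProductSpace ℂ E'] [CompleteSpace E] [CompleteSpace E']

theorem inner_rep_left (π : G →* (E ≃ₗᵢ[ℂ] E)) (g : G) (x y : E) :
    inner ℂ (π g x) y = inner ℂ x (π g⁻¹ y) := by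
  rw [← (π g⁻¹).inner_map_map (π g x) y]
  congr 1
  change (π g⁻¹ * π g) x = x
  rw [← map_mul]
  simp

theorem adjoint_intertwines {π : G →* (E ≃ₗᵢ[ℂ] E)} {ρ : G →* (E' ≃ₗᵢ[ℂ] E')}
    {A : E →L[ℂ] E'} (hA : ∀ g x, A (π g x) = ρ g (A x)) (g : G) (y : E') :
    ContinuousLinearMap.adjoint A (ρ g y) = π g (ContinuousLinearMap.adjoint A y) := by
  refine ext_inner_right ℂ fun x => ?_
  rw [ContinuousLinearMap.adjoint_inner_left, inner_rep_left, ← hA, inner_rep_left,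
    ContinuousLinearMap.adjoint_inner_left]

/-- An injective bounded intertwiner of unitary representations can be replaced by an isometric
one, namely the partial isometry of its polar decomposition. -/
theorem exists_isometric_intertwiner {π : G →* (E ≃ₗᵢ[ℂ] E)} {ρ : G →* (E' ≃ₗᵢ[ℂ] E')}
    {A : E →L[ℂ] E'} (hA : ∀ g x, A (π g x) = ρ g (A x)) (hinj : Function.Injective A) :
    ∃ V : E →ₗᵢ[ℂ] E', ∀ g x, V (π g x) = ρ g (V x) := by
  -- With `R = √(A*A)` one has `‖R x‖ = ‖A x‖`, so `R x ↦ A x` is a well-defined isometry on the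
  -- range of `R`.
  set D : E →L[ℂ] E := (ContinuousLinearMap.adjoint A).comp A with hD
  have hD0 : 0 ≤ D := by
    rw [ContinuousLinearMap.nonneg_iff_isPositive]
    exact ContinuousLinearMap.isPositive_adjoint_comp_self A
  set R : E →L[ℂ] E := CFC.sqrt D with hR
  have hRsa : IsSelfAdjoint R := (CFC.sqrt_nonneg D).isSelfAdjoint
  have hRR : ∀ x, R (R x) = D x := fun x =>
    DFunLike.congr_fun (CFC.sqrt_mul_sqrt_self D hD0) x
  have hRadj : ContinuousLinearMap.adjoint R = R := hRsa
  have hnorm : ∀ x, ‖A x‖ = ‖R x‖ := fun x => by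
    have h1 : inner ℂ (R x) (R x) = inner ℂ (A x) (A x) := by
      rw [← ContinuousLinearMap.adjoint_inner_right, hRadj, hRR, hD,
        ContinuousLinearMap.comp_apply, ContinuousLinearMap.adjoint_inner_right]
    rw [norm_eq_sqrt_re_inner (𝕜 := ℂ), ← h1, ← norm_eq_sqrt_re_inner]
  have hcomm : ∀ g x, R (π g x) = π g (R x) := fun g x => by
    have hDc : Commute D ((π g).toContinuousLinearEquiv : E →L[ℂ] E) := by
      refine ContinuousLinearMap.ext fun z => ?_
      change ContinuousLinearMap.adjoint A (A (π g z)) = π g (ContinuousLinearMap.adjoint A (A z))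
      rw [hA, adjoint_intertwines hA]
    -- The square root is a continuous function of `D`, so it commutes with whatever commutes with
    -- `D`.
    exact DFunLike.congr_fun (hDc.cfcₙ_nnreal NNReal.sqrt) x
  -- `R` is self-adjoint, so its range has orthogonal complement `ker R`, which is `ker A = 0`.
  have hdense : DenseRange (R : E →ₗ[ℂ] E) := by
    have h1 : (LinearMap.range (R : E →ₗ[ℂ] E)).topologicalClosure = ⊤ := by
      rw [Submodule.topologicalClosure_eq_top_iff, ContinuousLinearMap.orthogonal_range, hRadj,
        LinearMap.ker_eq_bot']
      intro x hx
      have h2 : ‖A x‖ = 0 := by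
        rw [hnorm]; exact norm_eq_zero.2 hx
      exact hinj (by rw [norm_eq_zero.1 h2, map_zero])
    exact Submodule.dense_iff_topologicalClosure_eq_top.2 h1
  obtain ⟨V, hV⟩ := exists_linearIsometry_of_norm_eq (R : E →ₗ[ℂ] E) (A : E →ₗ[ℂ] E') hdense hnorm
  have hV : ∀ x, V (R x) = A x := hV
  refine ⟨V, fun g x => ?_⟩
  refine congrFun (hdense.equalizer (g := fun x => V (π g x)) (h := fun x => ρ g (V x))
    (V.continuous.comp (π g).continuous) ((ρ g).continuous.comp V.continuous)
    (funext fun z => ?_)) x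
  change V (π g (R z)) = ρ g (V (R z))
  rw [← hcomm, hV, hV, hA]

end Intertwiners

/-! ### Embedding into the regular representation through the coefficient graph -/

section Regular

variable {G E : Type*} [Group G] [NormedAddCommGroup E] [InnerProductSpace ℂ E] [CompleteSpace E]

theorem equivSubrepresentation_of_isometry {E' : Type*} [NormedAddCommGroup E']
    [InnerProductSpace ℂ E'] {π : G →* (E ≃ₗᵢ[ℂ] E)} {ρ : G →* (E' ≃ₗᵢ[ℂ] E')}
    (V : E →ₗᵢ[ℂ] E') (hV : ∀ g x, V (π g x) = ρ g (V x)) : EquivSubrepresentation π ρ := by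
  refine ⟨LinearMap.range V.toLinearMap, ?_, ?_, V.equivRange, fun g x => hV g x⟩
  · rw [LinearMap.coe_range]
    exact V.isometry.isClosedEmbedding.isClosed_range
  · rintro g _ ⟨x, rfl⟩
    exact ⟨π g x, hV g x⟩

/-- The graph of the (closed, possibly unbounded) operator that sends `x` to the function
`g ↦ ⟨π g v, x⟩`, defined on those `x` for which this function lies in `ℓ²(G)`. -/
noncomputable def coeffGraph (π : G →* (E ≃ₗᵢ[ℂ] E)) (v : E) : Submodule ℂ (WithLp 2 (E × L2 G)) where
  carrier := {z | ∀ g, z.snd g = inner ℂ (π g v) z.fst}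
  zero_mem' g := by simp
  add_mem' {a b} ha hb g := by
    simp only [Set.mem_ofPred_eq] at ha hb
    simp [ha g, hb g]
  smul_mem' c a ha g := by
    simp only [Set.mem_ofPred_eq] at ha
    simp [ha g]

theorem mem_coeffGraph {π : G →* (E ≃ₗᵢ[ℂ] E)} {v : E} {z : WithLp 2 (E × L2 G)} :
    z ∈ coeffGraph π v ↔ ∀ g, z.snd g = inner ℂ (π g v) z.fst := Iff.rfl

/-- Closedness makes the graph a Hilbert space, as adjoints and polar decomposition on it require.
-/
theorem isClosed_coeffGraph (π : G →* (E ≃ₗᵢ[ℂ] E)) (v : E) :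
    IsClosed (coeffGraph π v : Set (WithLp 2 (E × L2 G))) := by
  have : (coeffGraph π v : Set (WithLp 2 (E × L2 G))) =
      ⋂ g, {z | z.snd g = inner ℂ (π g v) z.fst} := by
    ext z
    simp [mem_coeffGraph]
  rw [this]
  refine isClosed_iInter fun g => isClosed_eq ?_ ?_
  · have h1 : Continuous fun z : WithLp 2 (E × L2 G) => z.snd := by fun_prop
    exact ((continuous_apply g).comp (lp.uniformContinuous_coe (p := 2)).continuous).comp h1
  · fun_prop

theorem translate_mem_coeffGraph {π : G →* (E ≃ₗᵢ[ℂ] E)} {v : E} (k : G)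
    {z : WithLp 2 (E × L2 G)} (hz : z ∈ coeffGraph π v) :
    WithLp.toLp 2 (π k z.fst, leftRegular G k z.snd) ∈ coeffGraph π v := by
  intro g
  change z.snd (k⁻¹ * g) = inner ℂ (π g v) (π k z.fst)
  rw [mem_coeffGraph.1 hz, map_mul]
  change inner ℂ (π k⁻¹ (π g v)) _ = _
  rw [inner_rep_left, inv_inv]

/-- The unitary representation on the graph. -/
noncomputable def graphRep (π : G →* (E ≃ₗᵢ[ℂ] E)) (v : E) :
    G →* (coeffGraph π v ≃ₗᵢ[ℂ] coeffGraph π v) where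
  toFun k :=
    { toFun := fun z => ⟨_, translate_mem_coeffGraph k z.2⟩
      invFun := fun z => ⟨_, translate_mem_coeffGraph k⁻¹ z.2⟩
      left_inv := fun z => by
        ext1
        refine WithLp.ofLp_injective 2 (Prod.ext ?_ ?_)
        · change (π k⁻¹ * π k) _ = _
          rw [← map_mul]; simp
        · change (leftRegular G k⁻¹ * leftRegular G k) _ = _
          rw [← map_mul]; simp
      right_inv := fun z => by
        ext1
        refine WithLp.ofLp_injective 2 (Prod.ext ?_ ?_)
        · change (π k * π k⁻¹) _ = _
          rw [← map_mul]; simp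
        · change (leftRegular G k * leftRegular G k⁻¹) _ = _
          rw [← map_mul]; simp
      map_add' := fun z w => by
        ext1
        exact WithLp.ofLp_injective 2 (Prod.ext (map_add (π k) _ _) (map_add (leftRegular G k) _ _))
      map_smul' := fun c z => by
        ext1
        exact WithLp.ofLp_injective 2
          (Prod.ext (map_smul (π k) _ _) (map_smul (leftRegular G k) _ _))
      norm_map' := fun z => by
        change ‖WithLp.toLp 2 (π k z.1.fst, leftRegular G k z.1.snd)‖ = ‖z.1‖
        rw [WithLp.prod_norm_eq_of_L2, WithLp.prod_norm_eq_of_L2]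
        simp }
  map_one' := by
    refine LinearIsometryEquiv.ext fun z => ?_
    ext1
    refine WithLp.ofLp_injective 2 (Prod.ext ?_ ?_)
    · change π 1 _ = _
      simp
    · change leftRegular G 1 _ = _
      simp
  map_mul' a b := by
    refine LinearIsometryEquiv.ext fun z => ?_
    ext1
    refine WithLp.ofLp_injective 2 (Prod.ext ?_ ?_)
    · change π (a * b) _ = (π a * π b) _
      rw [map_mul]
    · change leftRegular G (a * b) _ = (leftRegular G a * leftRegular G b) _
      rw [map_mul]

/-- A unitary representation with a cyclic vector whose diagonal matrix coefficient is square
summable is equivalent to a subrepresentation of the left regular representation. -/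
theorem equivSubrepresentation_leftRegular {π : G →* (E ≃ₗᵢ[ℂ] E)} {v : E}
    (hv : Dense (Submodule.span ℂ (Set.range fun g => π g v) : Set E))
    (hsum : Summable fun g => ‖inner ℂ v (π g v)‖ ^ 2) :
    EquivSubrepresentation π (leftRegular G) := by
  have : CompleteSpace (coeffGraph π v) := (isClosed_coeffGraph π v).completeSpace_coe
  let p₁ : coeffGraph π v →L[ℂ] E := (WithLp.fstL 2 ℂ E (L2 G)).comp (coeffGraph π v).subtypeL
  let p₂ : coeffGraph π v →L[ℂ] L2 G := (WithLp.sndL 2 ℂ E (L2 G)).comp (coeffGraph π v).subtypeL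
  have h₁ : ∀ g z, p₁ (graphRep π v g z) = π g (p₁ z) := fun g z => rfl
  have h₂ : ∀ g z, p₂ (graphRep π v g z) = leftRegular G g (p₂ z) := fun g z => rfl
  have hp : ∀ z, ∀ g, p₂ z g = inner ℂ (π g v) (p₁ z) := fun z g => z.2 g
  -- A vector whose coefficients all vanish is orthogonal to the orbit of the cyclic vector.
  have hinj₂ : Function.Injective p₂ := by
    rw [injective_iff_map_eq_zero]
    intro z hz
    have hz1 : p₁ z = 0 := by
      refine hv.eq_zero_of_inner_right ℂ fun w hw => ?_
      induction hw using Submodule.span_induction with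
      | mem w hw => obtain ⟨g, rfl⟩ := hw; simp only; rw [← hp, hz]; rfl
      | zero => simp
      | add a b _ _ ha hb => rw [inner_add_left, ha, hb, add_zero]
      | smul c a _ ha => rw [inner_smul_left, ha, mul_zero]
    ext1
    exact WithLp.ofLp_injective 2 (Prod.ext hz1 hz)
  -- The orbit lies in the domain: the coefficient of `π h v` at `g` is `⟨v, π (g⁻¹ * h) v⟩`, and `g
  -- ↦ g⁻¹ * h` permutes `G`.
  have hrange : ∀ h, ∃ z, p₁ z = π h v := fun h => by
    have hm : Memℓp (fun g => inner ℂ (π g v) (π h v)) 2 := by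
      refine (memℓp_gen_iff (p := 2) (by norm_num)).2 ?_
      refine (((Equiv.inv G).trans (Equiv.mulRight h)).summable_iff.2 hsum).congr fun g => ?_
      have e : inner ℂ v (π (g⁻¹ * h) v) = inner ℂ (π g v) (π h v) := by
        rw [inner_rep_left, map_mul]; rfl
      simp only [Function.comp_apply, Equiv.trans_apply, Equiv.inv_apply, Equiv.coe_mulRight, e]
      norm_num
    exact ⟨⟨WithLp.toLp 2 (π h v, ⟨_, hm⟩), fun g => rfl⟩, rfl⟩
  -- The kernel of the adjoint is orthogonal to the range of `p₁`, which contains the orbit.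
  have hinj₁ : Function.Injective (ContinuousLinearMap.adjoint p₁) := by
    rw [injective_iff_map_eq_zero]
    intro x hx
    refine hv.eq_zero_of_inner_right ℂ fun w hw => ?_
    induction hw using Submodule.span_induction with
    | mem w hw =>
      obtain ⟨g, rfl⟩ := hw
      obtain ⟨z, hz⟩ := hrange g
      simp only
      rw [← hz, ← ContinuousLinearMap.adjoint_inner_right, hx, inner_zero_right]
    | zero => simp
    | add a b _ _ ha hb => rw [inner_add_left, ha, hb, add_zero]
    | smul c a _ ha => rw [inner_smul_left, ha, mul_zero]
  obtain ⟨V₁, hV₁⟩ := exists_isometric_intertwiner (adjoint_intertwines h₁) hinj₁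
  obtain ⟨V₂, hV₂⟩ := exists_isometric_intertwiner h₂ hinj₂
  exact equivSubrepresentation_of_isometry (V₂.comp V₁) fun g x => by simp [hV₁, hV₂]

end Regular

/-! ### Gram matrix of the translates of `u` -/

section Main

variable {G H : Type*} [Group G] [NormedAddCommGroup H] [InnerProductSpace ℂ H]
  {F : ℕ → Finset G} {u : G → H}

theorem norm_inner_le_of_bounded {C : ℝ} (hu : ∀ g, ‖u g‖ ≤ C) (a b : G) :
    ‖inner ℂ (u a) (u b)‖ ≤ C * C :=
  (norm_inner_le_norm _ _).trans
    (mul_le_mul (hu a) (hu b) (norm_nonneg _) ((norm_nonneg _).trans (hu a)))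

theorem tendsto_inner_cls (P : PermissiblePair F (fun h : G => translate h u)) (i j : G) :
    Tendsto (fun q => avg (F (P.N q)) (fun g => inner ℂ (u (g * i)) (u (g * j)))) atTop
      (𝓝 (inner ℂ (P.cls i) (P.cls j))) := by
  rw [PermissiblePair.cls, PermissiblePair.cls, PermissiblePair.inner_toSpace]
  exact P.tendsto_preInner (.mk (translate i u) (P.mem_preSubmodule i))
    (.mk (translate j u) (P.mem_preSubmodule j))

/-- Multiplying both indices by `g` right-translates the averaged function `x ↦ ⟨u (x * i), u (x *
j)⟩` by `g`. This function is bounded, so the averages change by a null sequence. -/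
theorem inner_cls_mul (hF : IsRightFolner F) {C : ℝ} (hu : ∀ g, ‖u g‖ ≤ C)
    (P : PermissiblePair F (fun h : G => translate h u)) (g i j : G) :
    inner ℂ (P.cls (g * i)) (P.cls (g * j)) = inner ℂ (P.cls i) (P.cls j) := by
  have h1 := (hF.tendsto_avg_translate_sub g
    (φ := fun x => inner ℂ (u (x * i)) (u (x * j)))
    fun x => norm_inner_le_of_bounded hu _ _).comp P.strictMono.tendsto_atTop
  have h2 := (tendsto_inner_cls P (g * i) (g * j)).sub (tendsto_inner_cls P i j)
  simp only [Function.comp_def, mul_assoc] at h1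
  exact sub_eq_zero.1 (tendsto_nhds_unique h2 h1)

theorem norm_avg_inner_le {C : ℝ} (hu : ∀ g, ‖u g‖ ≤ C) (A : Finset G) (h : G) :
    ‖avg A (fun g => inner ℂ (u g) (u (g * h)))‖ ≤ C * C := by
  have h1 := norm_sum_le_of_le A fun g _ => norm_inner_le_of_bounded hu g (g * h)
  rw [Finset.sum_const, nsmul_eq_mul] at h1
  rw [avg, norm_smul, norm_inv, Real.norm_natCast]
  rcases A.eq_empty_or_nonempty with rfl | hA
  · simpa using mul_self_nonneg C
  · rwa [inv_mul_le_iff₀ (by exact_mod_cast hA.card_pos)]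

theorem norm_inner_cls_sq_le {C : ℝ} (hu : ∀ g, ‖u g‖ ≤ C)
    (P : PermissiblePair F (fun h : G => translate h u)) (h : G) :
    ‖inner ℂ (P.cls 1) (P.cls h)‖ ^ 2 ≤
      limsup (fun n => ‖avg (F n) (fun g => inner ℂ (u g) (u (g * h)))‖ ^ 2) atTop := by
  -- A real `limsup` controls the sequence only when the sequence is bounded above; boundedness of
  -- `u` guarantees this.
  have hbdd : IsBoundedUnder (· ≤ ·) atTop
      (fun n => ‖avg (F n) (fun g => inner ℂ (u g) (u (g * h)))‖ ^ 2) :=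
    ⟨(C * C) ^ 2, eventually_map.2 (Eventually.of_forall fun n =>
      pow_le_pow_left₀ (norm_nonneg _) (norm_avg_inner_le hu _ _) 2)⟩
  have hlim := (tendsto_inner_cls P 1 h).norm.pow 2
  simp only [mul_one] at hlim
  refine le_of_forall_gt_imp_ge_of_dense fun b hb => le_of_tendsto hlim ?_
  exact (P.strictMono.tendsto_atTop.eventually (eventually_lt_of_limsup_lt hb hbdd)).mono
    fun q hq => hq.le

end Main

end VdC

theorem mainTheorem1 {G : Type*} [Group G] [Countable G] [Infinite G]
    {H : Type*} [NormedAddCommGroup H] [InnerProductSpace ℂ H] [CompleteSpace H]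
    (F : ℕ → Finset G) (hF : VdC.IsRightFolner F)
    (u : G → H) (hu : ∃ C : ℝ, ∀ g, ‖u g‖ ≤ C)
    (hsum : Summable fun h : G =>
      limsup (fun n => ‖VdC.avg (F n) (fun g => inner ℂ (u g) (u (g * h)))‖ ^ 2) atTop) :
    VdC.SpectrallyLebesgue F u := by
  obtain ⟨C, hC⟩ := hu
  intro P
  have := P.completeSpace_space hF.tendsto_card
  refine ⟨VdC.existsUnique_rep_of_inner_eq P.dense_span_cls (VdC.inner_cls_mul hF hC P), fun U hU => ?_⟩
  -- The orbit of `P.cls 1` is the whole family of classes, so this vector is cyclic.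
  have hcls : ∀ g, U g (P.cls 1) = P.cls g := fun g => by simpa using hU g 1
  refine VdC.equivSubrepresentation_leftRegular (v := P.cls 1) ?_ ?_
  · simpa only [hcls] using P.dense_span_cls
  · simp only [hcls]
    exact hsum.of_nonneg_of_le (fun _ => sq_nonneg _) (VdC.norm_inner_cls_sq_le hC P)
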